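/- Let $(\Omega,\mathcal F,(\mathcal F_t)_{t\ge 0},\mathbb P)$ be a filtered probability space and let $X=(X_t)_{t\ge0}$ be a positive (i.e. nonnegative) local submartingale which decomposes as $X_t=N_t+A_t$, where $N$ is a càdlàg local martingale with $N_0=0$ and $A$ is a continuous, adapted, increasing (i.e. nondecreasing) process with $A_0=0$ (path properties hold almost surely). Put $X_t^*=\sup_{s\le t}X_s$, $X^*_\infty=\sup_{s\ge 0}X_s\in[0,\infty]$ and $A_\infty=\lim_{t\to\infty}A_t\in[0,\infty]$. Then for every $k\in(0,1)$, $$\mathbb E\left[(X^*_\infty)^k\right]\le\frac{2-k}{1-k}\,\mathbb E\left[A_\infty^k\right],$$ both sides being allowed to be $+\infty$. If furthermore the process $(X^*_t)$ is (almost surely) continuous, then for every $k\in(0,1)$ also $$\mathbb E\left[A_\infty^k\right]\le\frac{2-k}{1-k}\,\mathbb E\left[(X^*_\infty)^k\right],$$ so that $$\mathbb E\left[(X^*_\infty)^k\right]\le\frac{2-k}{1-k}\,\mathbb E\left[A_\infty^k\right]\le\left(\frac{2-k}{1-k}\right)^2\mathbb E\left[(X^*_\infty)^k\right].$$ The process $(X_t^*)$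 is almost surely continuous whenever $X$ has only negative jumps, i.e. almost surely $X_t\le X_{t-}$ for all $t>0$. -/

import Mathlib

open MeasureTheory ProbabilityTheory Filter Topology
open scoped NNReal ENNReal

namespace LocalSubmart

variable {Ω : Type*} [mΩ : MeasurableSpace Ω]

/-- A path is càdlàg: right-continuous, with left limits in `ℝ`. -/
def IsCadlagPath (f : ℝ≥0 → ℝ) : Prop :=
  ∀ t : ℝ≥0, ContinuousWithinAt f (Set.Ici t) t ∧ ∃ l : ℝ, Tendsto f (𝓝[<] t) (𝓝 l)

/-- A (real) local martingale: an adapted process, reduced to martingales by a sequence of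
stopping times increasing to infinity. -/
def IsLocalMartingale (N : ℝ≥0 → Ω → ℝ) (𝓕 : Filtration ℝ≥0 mΩ) (P : Measure Ω) : Prop :=
  StronglyAdapted 𝓕 N ∧ Locally (fun M ↦ Martingale M 𝓕 P) 𝓕 N P

/-- A (real) local submartingale: an adapted process, reduced to submartingales by a sequence of
stopping times increasing to infinity. -/
def IsLocalSubmartingale (X : ℝ≥0 → Ω → ℝ) (𝓕 : Filtration ℝ≥0 mΩ) (P : Measure Ω) : Prop :=
  StronglyAdapted 𝓕 X ∧ Locally (fun M ↦ Submartingale M 𝓕 P) 𝓕 X P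

/-- `A` is a continuous increasing process: adapted, and almost surely continuous,
nondecreasing and null at time `0`. -/
structure IsContinuousIncreasing (A : ℝ≥0 → Ω → ℝ) (𝓕 : Filtration ℝ≥0 mΩ)
    (P : Measure Ω) : Prop where
  adapted : StronglyAdapted 𝓕 A
  continuous : ∀ᵐ ω ∂P, Continuous fun t ↦ A t ω
  monotone : ∀ᵐ ω ∂P, Monotone fun t ↦ A t ω
  zero : ∀ᵐ ω ∂P, A 0 ω = 0

/-- The decomposition `X = N + A` of a positive (that is, nonnegative) local submartingale `X`
into a càdlàg local martingale `N` with `N 0 = 0` and a continuous increasing process `A`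
with `A 0 = 0`. -/
structure IsPositiveLocalSubmartingaleDecomp (X N A : ℝ≥0 → Ω → ℝ) (𝓕 : Filtration ℝ≥0 mΩ)
    (P : Measure Ω) : Prop where
  localSubmartingale : IsLocalSubmartingale X 𝓕 P
  nonneg : ∀ᵐ ω ∂P, ∀ t, 0 ≤ X t ω
  localMartingale : IsLocalMartingale N 𝓕 P
  cadlag : ∀ᵐ ω ∂P, IsCadlagPath fun t ↦ N t ω
  zero : ∀ᵐ ω ∂P, N 0 ω = 0
  increasing : IsContinuousIncreasing A 𝓕 P
  decomp : ∀ᵐ ω ∂P, ∀ t, X t ω = N t ω + A t ω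

/-- The running supremum `sup_{s ≤ t} Y s` of a nonnegative process, with values in `[0, ∞]`. -/
noncomputable def runningSup (Y : ℝ≥0 → Ω → ℝ) (t : ℝ≥0) (ω : Ω) : ℝ≥0∞ :=
  ⨆ s : Set.Iic t, ENNReal.ofReal (Y s ω)

/-- The overall supremum `sup_{s ≥ 0} Y s` of a nonnegative process, with values in `[0, ∞]`.
For `Y` nondecreasing it is the limit of `Y t` as `t → ∞`. -/
noncomputable def totalSup (Y : ℝ≥0 → Ω → ℝ) (ω : Ω) : ℝ≥0∞ :=
  ⨆ s : ℝ≥0, ENNReal.ofReal (Y s ω)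

/-- Almost surely, all jumps `Y t - Y (t-)` are nonpositive. -/
def HasOnlyNegativeJumps (Y : ℝ≥0 → Ω → ℝ) (P : Measure Ω) : Prop :=
  ∀ᵐ ω ∂P, ∀ t : ℝ≥0, Y t ω - Function.leftLim (fun s ↦ Y s ω) t ≤ 0

end LocalSubmart

namespace LocalSubmart

/-! This is Lenglart's domination argument. Say `U` is to be controlled by `V`, where `U - V` has
mean zero at localised bounded random times. Stop when either process first exceeds `x`. If `V`
cannot jump over a level, it is still at most `x` then, so the stopped mean of `U` is at most
`E[min(V*, x)]`, and Markov gives `x P(U* > x, V* ≤ x) ≤ E[min(V*, x)]` (`mul_measure_totalSup_le`).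
Integrating against `k x^(k-1) dx` yields the moment bound: the event `V* > x` contributes 1 and the
truncated mean `1/(1-k)`, which sum to `(2-k)/(1-k)` (`lintegral_rpow_le_of_mul_measure_le`). Take
`(U, V) = (X, A)`, then `(A, X)`: the centering is symmetric, and not overshooting follows from
continuity of `A`, respectively of the running supremum of `X`. -/

lemma untopA_coe (s : ℝ≥0) : (s : WithTop ℝ≥0).untopA = s :=
  WithTop.untopD_coe _ s

/-- `S ∧ τ`, for a random time `S` and a possibly infinite random time `τ`. -/
noncomputable def minTime {Ω : Type*} (S : Ω → ℝ≥0) (τ : Ω → WithTop ℝ≥0) (ω : Ω) : ℝ≥0 :=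
  (min (S ω : WithTop ℝ≥0) (τ ω)).untopA

lemma coe_untopA_min (s : ℝ≥0) (c : WithTop ℝ≥0) :
    (((min (s : WithTop ℝ≥0) c).untopA : ℝ≥0) : WithTop ℝ≥0) = min (s : WithTop ℝ≥0) c := by
  cases c with
  | top => rw [min_eq_left le_top, untopA_coe]
  | coe c => rw [← WithTop.coe_min, untopA_coe]

lemma minTime_le {Ω : Type*} (S : Ω → ℝ≥0) (τ : Ω → WithTop ℝ≥0) (ω : Ω) : minTime S τ ω ≤ S ω := by
  rw [← WithTop.coe_le_coe, minTime, coe_untopA_min]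
  exact min_le_left _ _

lemma minTime_eq_of_le {Ω : Type*} {S : Ω → ℝ≥0} {τ : Ω → WithTop ℝ≥0} {ω : Ω}
    (h : (S ω : WithTop ℝ≥0) ≤ τ ω) : minTime S τ ω = S ω := by
  rw [minTime, min_eq_left h, untopA_coe]

lemma continuousWithinAt_stopped {f : ℝ≥0 → ℝ}
    (hf : ∀ t, ContinuousWithinAt f (Set.Ici t) t) (c : WithTop ℝ≥0) (t : ℝ≥0) :
    ContinuousWithinAt (fun s : ℝ≥0 ↦ f (min (s : WithTop ℝ≥0) c).untopA) (Set.Ici t) t := by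
  cases c with
  | top =>
    simp only [min_eq_left le_top, untopA_coe]
    exact hf t
  | coe c =>
    have h : ∀ s : ℝ≥0, (min (s : WithTop ℝ≥0) (c : WithTop ℝ≥0)).untopA = min s c := by
      intro s
      rw [← WithTop.coe_min, untopA_coe]
    simp only [h]
    refine ContinuousWithinAt.comp (f := fun s ↦ min s c) (t := Set.Ici (min t c)) (hf _) ?_ ?_
    · exact (continuous_id.min continuous_const).continuousWithinAt
    · intro s hs
      exact min_le_min_right c hs

/-! ### Optional stopping at optional times, without right-continuity of the filtration -/

section OptionalStopping

variable {Ω : Type*} [mΩ : MeasurableSpace Ω] {P : Measure Ω} {𝓕 : Filtration ℝ≥0 mΩ}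

/-- A random time `S` is optional if `{S < q}` is known at time `q`, for every `q`. -/
def IsOptionalTime (𝓕 : Filtration ℝ≥0 mΩ) (S : Ω → ℝ≥0) : Prop :=
  ∀ q, MeasurableSet[𝓕 q] {ω | S ω < q}

/-- The smallest multiple of `1 / (m + 1)` strictly above `s`. -/
noncomputable def ceilGrid (m : ℕ) (s : ℝ≥0) : ℝ≥0 :=
  ((⌊((m : ℝ≥0) + 1) * s⌋₊ : ℝ≥0) + 1) / ((m : ℝ≥0) + 1)

lemma lt_ceilGrid (m : ℕ) (s : ℝ≥0) : s < ceilGrid m s := by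
  have hm : (0 : ℝ≥0) < (m : ℝ≥0) + 1 := by positivity
  rw [ceilGrid, lt_div_iff₀ hm, mul_comm]
  exact Nat.lt_floor_add_one _

lemma ceilGrid_le (m : ℕ) (s : ℝ≥0) : ceilGrid m s ≤ s + 1 / ((m : ℝ≥0) + 1) := by
  have hm : (0 : ℝ≥0) < (m : ℝ≥0) + 1 := by positivity
  rw [ceilGrid, div_le_iff₀ hm, add_mul s, one_div, inv_mul_cancel₀ hm.ne', mul_comm s]
  gcongr
  exact Nat.floor_le (by positivity)

/-- Because the rounding is strictly upward, the condition becomes a strict bound on `s` by a grid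
point not exceeding `q`. This is the kind of event an optional time controls. -/
lemma ceilGrid_le_iff (m : ℕ) (s q : ℝ≥0) :
    ceilGrid m s ≤ q ↔ s < (⌊((m : ℝ≥0) + 1) * q⌋₊ : ℝ≥0) / ((m : ℝ≥0) + 1) := by
  have hm : (0 : ℝ≥0) < (m : ℝ≥0) + 1 := by positivity
  rw [ceilGrid, div_le_iff₀ hm, lt_div_iff₀ hm, mul_comm s, mul_comm q,
    ← Nat.floor_lt (by positivity), ← Nat.succ_le_iff, Nat.le_floor_iff (by positivity)]
  push_cast
  rfl

lemma tendsto_ceilGrid (s : ℝ≥0) : Tendsto (fun m ↦ ceilGrid m s) atTop (𝓝[≥] s) := by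
  refine tendsto_nhdsWithin_iff.2 ⟨?_, Eventually.of_forall fun m ↦ (lt_ceilGrid m s).le⟩
  have h : Tendsto (fun m : ℕ ↦ s + 1 / ((m : ℝ≥0) + 1)) atTop (𝓝 (s + 0)) :=
    tendsto_const_nhds.add (tendsto_one_div_add_atTop_nhds_zero_nat (𝕜 := ℝ≥0))
  rw [add_zero] at h
  exact tendsto_of_tendsto_of_tendsto_of_le_of_le tendsto_const_nhds h
    (fun m ↦ (lt_ceilGrid m s).le) (fun m ↦ ceilGrid_le m s)

lemma IsOptionalTime.isStoppingTime_ceilGrid {S : Ω → ℝ≥0} (hS : IsOptionalTime 𝓕 S) (m : ℕ) :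
    IsStoppingTime 𝓕 (fun ω ↦ ((ceilGrid m (S ω) : ℝ≥0) : WithTop ℝ≥0)) := by
  intro q
  have hm : (0 : ℝ≥0) < (m : ℝ≥0) + 1 := by positivity
  simp only [WithTop.coe_le_coe, ceilGrid_le_iff]
  refine 𝓕.mono ?_ _ (hS _)
  rw [div_le_iff₀ hm, mul_comm q]
  exact Nat.floor_le (by positivity)

/-- Optional stopping at a bounded optional time, for a right-continuous martingale. -/
theorem integrable_and_integral_optionalTime [IsFiniteMeasure P] {M : ℝ≥0 → Ω → ℝ}
    (hM : Martingale M 𝓕 P)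
    (hMc : ∀ᵐ ω ∂P, ∀ t, ContinuousWithinAt (fun s ↦ M s ω) (Set.Ici t) t)
    {S : Ω → ℝ≥0} (hS : IsOptionalTime 𝓕 S) {t : ℝ≥0} (hSt : ∀ ω, S ω ≤ t) :
    Integrable (fun ω ↦ M (S ω) ω) P ∧ ∫ ω, M (S ω) ω ∂P = ∫ ω, M 0 ω ∂P := by
  have hst := fun m ↦ hS.isStoppingTime_ceilGrid m
  have hbd : ∀ m ω, ((ceilGrid m (S ω) : ℝ≥0) : WithTop ℝ≥0) ≤ ((t + 1 : ℝ≥0) : WithTop ℝ≥0) := by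
    intro m ω
    refine WithTop.coe_le_coe.2 ((ceilGrid_le m _).trans (add_le_add (hSt ω) ?_))
    rw [div_le_iff₀ (by positivity), one_mul]
    exact le_add_of_nonneg_left (by positivity)
  have hle := fun m ↦ (hst m).measurableSpace_le_of_le (hbd m)
  have hcount : ∀ m, (Set.range fun ω ↦ ((ceilGrid m (S ω) : ℝ≥0) : WithTop ℝ≥0)).Countable := by
    intro m
    refine (Set.countable_range fun n : ℕ ↦
      ((((n : ℝ≥0) + 1) / ((m : ℝ≥0) + 1) : ℝ≥0) : WithTop ℝ≥0)).mono ?_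
    rintro _ ⟨ω, rfl⟩
    exact ⟨_, rfl⟩
  have hcond : ∀ m, (fun ω ↦ M (ceilGrid m (S ω)) ω) =ᵐ[P]
      P[M (t + 1) | (hst m).measurableSpace] := fun m ↦
    hM.stoppedValue_ae_eq_condExp_of_le_const_of_countable_range (hst m) (hbd m) (hcount m)
  -- Conditional expectations of a single integrable variable are uniformly integrable, so the
  -- pointwise limit given by right-continuity is also an `L¹` limit.
  have hUI : UniformIntegrable (fun m ↦ P[M (t + 1) | (hst m).measurableSpace]) 1 P :=
    (hM.integrable (t + 1)).uniformIntegrable_condExp hle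
  have hlim : ∀ᵐ ω ∂P, Tendsto (fun m ↦ (P[M (t + 1) | (hst m).measurableSpace]) ω) atTop
      (𝓝 (M (S ω) ω)) := by
    filter_upwards [hMc, ae_all_iff.2 hcond] with ω hω hω'
    simp only [← hω']
    exact (hω (S ω)).tendsto.comp (tendsto_ceilGrid (S ω))
  have hmem : MemLp (fun ω ↦ M (S ω) ω) 1 P := hUI.memLp_of_ae_tendsto hlim
  refine ⟨memLp_one_iff_integrable.1 hmem, ?_⟩
  have hconv := tendsto_integral_of_L1' _ hmem.1 (Eventually.of_forall fun m ↦ integrable_condExp)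
    (tendsto_Lp_finite_of_tendsto_ae le_rfl ENNReal.one_ne_top hUI.1 hmem hUI.2.1 hlim)
  simp only [integral_condExp (hle _)] at hconv
  rw [tendsto_nhds_unique hconv tendsto_const_nhds]
  simpa using (hM.setIntegral_eq (zero_le : (0 : ℝ≥0) ≤ t + 1) MeasurableSet.univ).symm

/-- Localised optional stopping for a right-continuous local martingale null at zero. -/
theorem IsLocalMartingale.exists_seq_integral_eq_zero [IsFiniteMeasure P] {N : ℝ≥0 → Ω → ℝ}
    (hN : IsLocalMartingale N 𝓕 P)
    (hNc : ∀ᵐ ω ∂P, ∀ t, ContinuousWithinAt (fun s ↦ N s ω) (Set.Ici t) t)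
    (hN0 : ∀ᵐ ω ∂P, N 0 ω = 0) {S : Ω → ℝ≥0} (hS : IsOptionalTime 𝓕 S) {t : ℝ≥0}
    (hSt : ∀ ω, S ω ≤ t) :
    ∃ σ : ℕ → Ω → ℝ≥0, (∀ n ω, σ n ω ≤ S ω) ∧ (∀ᵐ ω ∂P, ∀ᶠ n in atTop, σ n ω = S ω) ∧
      ∀ n, Integrable (fun ω ↦ N (σ n ω) ω) P ∧ ∫ ω, N (σ n ω) ω ∂P = 0 := by
  obtain ⟨-, τ, hτ, hM⟩ := hN
  refine ⟨fun n ↦ minTime S (τ n), fun n ω ↦ minTime_le _ _ _, ?_, fun n ↦ ?_⟩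
  · filter_upwards [hτ.tendsto_top] with ω hω
    filter_upwards [(WithTop.tendsto_nhds_top_iff _).1 hω (S ω)] with n hn
    exact minTime_eq_of_le hn.le
  -- Localisation multiplies by the indicator of `⊥ < τ n`; since `N` vanishes at time zero, this
  -- almost surely changes nothing.
  · set M := stoppedProcess (fun i ↦ {ω | ⊥ < τ n ω}.indicator (N i)) (τ n) with hMdef
    have hind : ∀ s ω, M s ω =
        {ω | ⊥ < τ n ω}.indicator (fun ω ↦ N (min (s : WithTop ℝ≥0) (τ n ω)).untopA ω) ω := by
      intro s ω
      rw [hMdef, stoppedProcess_indicator_comm]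
      rfl
    have hMN : ∀ᵐ ω ∂P, ∀ s, M s ω = N (min (s : WithTop ℝ≥0) (τ n ω)).untopA ω := by
      filter_upwards [hN0] with ω hω s
      rw [hind]
      by_cases h : ⊥ < τ n ω
      · exact Set.indicator_of_mem (s := {ω | ⊥ < τ n ω}) h _
      · rw [Set.indicator_of_notMem (s := {ω | ⊥ < τ n ω}) h]
        have h0 : τ n ω = ((0 : ℝ≥0) : WithTop ℝ≥0) := not_bot_lt_iff.1 h
        rw [h0, ← WithTop.coe_min, untopA_coe]
        simp [hω]
    have hMc : ∀ᵐ ω ∂P, ∀ t, ContinuousWithinAt (fun s ↦ M s ω) (Set.Ici t) t := by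
      filter_upwards [hMN, hNc] with ω hω hc u
      simp only [hω]
      exact continuousWithinAt_stopped hc _ u
    have hMS : (fun ω ↦ M (S ω) ω) =ᵐ[P] fun ω ↦ N (minTime S (τ n) ω) ω := by
      filter_upwards [hMN] with ω hω
      exact hω _
    obtain ⟨h1, h2⟩ := integrable_and_integral_optionalTime (hM n) hMc hS hSt
    refine ⟨h1.congr hMS, ?_⟩
    rw [← integral_congr_ae hMS, h2]
    refine integral_eq_zero_of_ae ?_
    filter_upwards [hMN, hN0] with ω hω h0
    refine (hω 0).trans ?_
    rw [min_eq_left (by exact bot_le), untopA_coe, h0]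
    rfl

end OptionalStopping

/-! ### Lenglart's domination inequality -/

section Lenglart

lemma exists_mem_dense_lt {D : Set ℝ≥0} (hD : Dense D) {f : ℝ≥0 → ℝ} {t b : ℝ≥0} {a : ℝ}
    (hf : ContinuousWithinAt f (Set.Ici t) t) (ha : a < f t) (htb : t < b) :
    ∃ d ∈ D, t < d ∧ d < b ∧ a < f d := by
  have h1 : ∀ᶠ s in 𝓝[≥] t, a < f s := hf.eventually (lt_mem_nhds ha)
  obtain ⟨u, hu, hu'⟩ := (mem_nhdsGE_iff_exists_Ico_subset' htb).1 h1
  obtain ⟨d, hd, htd, hdu⟩ := hD.exists_between (lt_min hu htb)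
  exact ⟨d, hd, htd, hdu.trans_le (min_le_right _ _),
    hu' ⟨htd.le, hdu.trans_le (min_le_left _ _)⟩⟩

variable {Ω : Type*} [mΩ : MeasurableSpace Ω] {P : Measure Ω} {𝓕 : Filtration ℝ≥0 mΩ}
  {U V : ℝ≥0 → Ω → ℝ}

omit mΩ in
lemma totalSup_eq_iSup_dense {D : Set ℝ≥0} (hD : Dense D) {ω : Ω}
    (hU : ∀ t, ContinuousWithinAt (fun s ↦ U s ω) (Set.Ici t) t) :
    totalSup U ω = ⨆ d : D, ENNReal.ofReal (U d ω) := by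
  refine le_antisymm (iSup_le fun t ↦ le_of_forall_lt fun c hc ↦ ?_)
    (iSup_le fun d ↦ le_iSup (fun s ↦ ENNReal.ofReal (U s ω)) (d : ℝ≥0))
  obtain ⟨d, hd, -, -, h⟩ := exists_mem_dense_lt hD (hU t)
    ((ENNReal.lt_ofReal_iff_toReal_lt hc.ne_top).1 hc) (lt_add_one t)
  exact ((ENNReal.lt_ofReal_iff_toReal_lt hc.ne_top).2 h).trans_le
    (le_iSup (fun d : D ↦ ENNReal.ofReal (U d ω)) ⟨d, hd⟩)

lemma aemeasurable_totalSup (hUa : StronglyAdapted 𝓕 U)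
    (hU : ∀ᵐ ω ∂P, ∀ t, ContinuousWithinAt (fun s ↦ U s ω) (Set.Ici t) t) :
    AEMeasurable (totalSup U) P := by
  obtain ⟨D, hDc, hD⟩ := TopologicalSpace.exists_countable_dense ℝ≥0
  have := hDc.to_subtype
  refine ⟨fun ω ↦ ⨆ d : D, ENNReal.ofReal (U d ω), ?_, ?_⟩
  · exact Measurable.iSup fun d ↦ ((hUa d).mono (𝓕.le _)).measurable.ennreal_ofReal
  · filter_upwards [hU] with ω hω using totalSup_eq_iSup_dense hD hω

/-- The first time, along the dense set `D` and capped at `t`, at which `U` or `V` exceeds `x`. -/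
noncomputable def exceedTime (D : Set ℝ≥0) (U V : ℝ≥0 → Ω → ℝ) (x : ℝ) (t : ℝ≥0) (ω : Ω) : ℝ≥0 :=
  sInf ({s | s ∈ D ∧ (x < U s ω ∨ x < V s ω)} ∪ {t})

omit mΩ in
lemma exceedTime_le (D : Set ℝ≥0) (U V : ℝ≥0 → Ω → ℝ) (x : ℝ) (t : ℝ≥0) (ω : Ω) :
    exceedTime D U V x t ω ≤ t :=
  csInf_le (OrderBot.bddBelow _) (Or.inr rfl)

lemma isOptionalTime_exceedTime {D : Set ℝ≥0} (hD : D.Countable) (hUa : StronglyAdapted 𝓕 U)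
    (hVa : StronglyAdapted 𝓕 V) (x : ℝ) (t : ℝ≥0) :
    IsOptionalTime 𝓕 (exceedTime D U V x t) := by
  intro q
  have h : {ω | exceedTime D U V x t ω < q} =
      {_ω | t < q} ∪ ⋃ s ∈ D ∩ Set.Iio q, ({ω | x < U s ω} ∪ {ω | x < V s ω}) := by
    ext ω
    simp only [exceedTime, Set.mem_ofPred_eq, Set.mem_union, Set.mem_iUnion,
      csInf_lt_iff (OrderBot.bddBelow _) (Set.Nonempty.inr (Set.singleton_nonempty t)),
      Set.mem_singleton_iff, Set.mem_inter_iff, Set.mem_Iio]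
    constructor
    · rintro ⟨s, ⟨hs, h⟩ | rfl, hq⟩
      · exact Or.inr ⟨s, ⟨hs, hq⟩, h⟩
      · exact Or.inl hq
    · rintro (h | ⟨s, ⟨hs, hq⟩, h⟩)
      · exact ⟨t, Or.inr rfl, h⟩
      · exact ⟨s, Or.inl ⟨hs, h⟩, hq⟩
  rw [h]
  refine MeasurableSet.union (MeasurableSet.const _)
    (MeasurableSet.biUnion (hD.mono Set.inter_subset_left) fun s hs ↦ ?_)
  have hle := 𝓕.mono (le_of_lt hs.2)
  exact (measurableSet_lt measurable_const ((hUa s).mono hle).measurable).union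
    (measurableSet_lt measurable_const ((hVa s).mono hle).measurable)

omit mΩ in
lemma le_of_lt_exceedTime {D : Set ℝ≥0} (hD : Dense D) {x : ℝ} {t : ℝ≥0} {ω : Ω}
    (hV : ∀ t, ContinuousWithinAt (fun s ↦ V s ω) (Set.Ici t) t) {r : ℝ≥0}
    (hr : r < exceedTime D U V x t ω) : V r ω ≤ x := by
  by_contra! hc
  obtain ⟨d, hd, -, hdS, h⟩ := exists_mem_dense_lt hD (hV r) hc hr
  exact notMem_of_lt_csInf hdS (OrderBot.bddBelow _) (Or.inl ⟨hd, Or.inr h⟩)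

omit mΩ in
-- If `U` were below `x` at the infimum, right-continuity would keep it below `x` for a while. But
-- exceedance times come arbitrarily close from the right, and they are all due to `U`, as `V` never
-- passes `x`.
lemma le_exceedTime_value {D : Set ℝ≥0} (hD : Dense D) {x : ℝ} {t : ℝ≥0} {ω : Ω}
    (hU : ∀ t, ContinuousWithinAt (fun s ↦ U s ω) (Set.Ici t) t)
    (hV : ∀ s, V s ω ≤ x) {r : ℝ≥0} (hrt : r < t) (hr : x < U r ω) :
    x ≤ U (exceedTime D U V x t ω) ω := by
  obtain ⟨d, hd, -, hdt, hxd⟩ := exists_mem_dense_lt hD (hU r) hr hrt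
  by_contra! hc
  set S := exceedTime D U V x t ω with hS
  have hSd : S ≤ d := csInf_le (OrderBot.bddBelow _) (Or.inl ⟨hd, Or.inl hxd⟩)
  have hSt : S < t := hSd.trans_lt hdt
  have h1 : ∀ᶠ s in 𝓝[≥] S, U s ω < x := (hU S).eventually (gt_mem_nhds hc)
  obtain ⟨u, hu, hu'⟩ := (mem_nhdsGE_iff_exists_Ico_subset' hSt).1 h1
  obtain ⟨s, hs, hsu⟩ := exists_lt_of_csInf_lt (Set.Nonempty.inr (Set.singleton_nonempty t))
    (lt_min hu hSt : sInf _ < _)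
  have hSs : S ≤ s := csInf_le (OrderBot.bddBelow _) hs
  rcases hs with ⟨-, h | h⟩ | rfl
  · exact lt_asymm h (hu' ⟨hSs, hsu.trans_le (min_le_left _ _)⟩)
  · exact absurd h (hV s).not_gt
  · exact lt_irrefl _ (hsu.trans_le (min_le_right _ _))

/-- `U - V` has zero mean at localised bounded optional times. -/
def IsLocallyCentered (U V : ℝ≥0 → Ω → ℝ) (𝓕 : Filtration ℝ≥0 mΩ) (P : Measure Ω) : Prop :=
  ∀ S : Ω → ℝ≥0, IsOptionalTime 𝓕 S → ∀ t, (∀ ω, S ω ≤ t) →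
    ∃ σ : ℕ → Ω → ℝ≥0, (∀ n ω, σ n ω ≤ S ω) ∧ (∀ᵐ ω ∂P, ∀ᶠ n in atTop, σ n ω = S ω) ∧
      ∀ n, Integrable (fun ω ↦ U (σ n ω) ω - V (σ n ω) ω) P ∧
        ∫ ω, (U (σ n ω) ω - V (σ n ω) ω) ∂P = 0

/-- The hypothesis `hV` says that `V` does not overshoot a level, so `V` is at most `x` up to and
including the exceedance time. Markov's inequality and Fatou's lemma then remove the localisation.
-/
lemma mul_measure_exceed_before_le [IsFiniteMeasure P]
    (hUa : StronglyAdapted 𝓕 U) (hVa : StronglyAdapted 𝓕 V)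
    (hU0 : ∀ᵐ ω ∂P, ∀ t, 0 ≤ U t ω)
    (hUc : ∀ᵐ ω ∂P, ∀ t, ContinuousWithinAt (fun s ↦ U s ω) (Set.Ici t) t)
    (hVc : ∀ᵐ ω ∂P, ∀ t, ContinuousWithinAt (fun s ↦ V s ω) (Set.Ici t) t)
    (hV : ∀ᵐ ω ∂P, ∀ y : ℝ, 0 ≤ y → ∀ s, (∀ r < s, V r ω ≤ y) → V s ω ≤ y)
    (hUV : IsLocallyCentered U V 𝓕 P) {x : ℝ} (hx : 0 < x) (t : ℝ≥0) :
    ENNReal.ofReal x * P {ω | (∃ r < t, x < U r ω) ∧ ∀ s, V s ω ≤ x} ≤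
      ∫⁻ ω, min (totalSup V ω) (ENNReal.ofReal x) ∂P := by
  obtain ⟨D, hDc, hD⟩ := TopologicalSpace.exists_countable_dense ℝ≥0
  set S := exceedTime D U V x t with hS
  obtain ⟨σ, hσS, hσ, hint⟩ := hUV S (isOptionalTime_exceedTime hDc hUa hVa x t) t
    (exceedTime_le D U V x t)
  set Z : Ω → ℝ≥0∞ := fun ω ↦ min (totalSup V ω) (ENNReal.ofReal x) with hZ
  have hZm : AEMeasurable Z P := (aemeasurable_totalSup hVa hVc).min aemeasurable_const
  have hZx : ∀ ω, Z ω ≤ ENNReal.ofReal x := fun ω ↦ min_le_right _ _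
  have hZt : ∀ ω, Z ω ≠ ⊤ := fun ω ↦ ne_top_of_le_ne_top ENNReal.ofReal_ne_top (hZx ω)
  have hZint : ∫⁻ ω, Z ω ∂P ≠ ⊤ := by
    refine ne_top_of_le_ne_top ?_ (lintegral_mono hZx)
    rw [lintegral_const]
    exact ENNReal.mul_ne_top ENNReal.ofReal_ne_top (measure_ne_top _ _)
  have hWi : Integrable (fun ω ↦ (Z ω).toReal) P := integrable_toReal_of_lintegral_ne_top hZm hZint
  -- Only the difference `U - V` is known to be integrable at `σ n`. Adding `Z` gives a majorant of
  -- `U` at `σ n` whose integral is exactly that of `Z`.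
  set g : ℕ → Ω → ℝ := fun n ω ↦ (U (σ n ω) ω - V (σ n ω) ω) + (Z ω).toReal with hg
  have hgi : ∀ n, Integrable (g n) P := fun n ↦ (hint n).1.add hWi
  have hUg : ∀ᵐ ω ∂P, ∀ n, U (σ n ω) ω ≤ g n ω := by
    filter_upwards [hVc, hV] with ω hVω hω n
    have hle : V (σ n ω) ω ≤ x := hω x hx.le _ fun r hr ↦
      le_of_lt_exceedTime hD hVω (hr.trans_le (hσS n ω))
    have : ENNReal.ofReal (V (σ n ω) ω) ≤ Z ω :=
      le_min (le_iSup (fun s ↦ ENNReal.ofReal (V s ω)) (σ n ω)) (ENNReal.ofReal_le_ofReal hle)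
    have h2 := (ENNReal.ofReal_le_iff_le_toReal (hZt ω)).1 this
    simp only [hg]
    linarith
  have hgl : ∀ n, ∫⁻ ω, ENNReal.ofReal (g n ω) ∂P = ∫⁻ ω, Z ω ∂P := by
    intro n
    rw [← ofReal_integral_eq_lintegral_ofReal (hgi n), integral_add (hint n).1 hWi, (hint n).2,
      zero_add, integral_toReal hZm (ae_of_all _ fun ω ↦ (hZt ω).lt_top),
      ENNReal.ofReal_toReal hZint]
    filter_upwards [hUg, hU0] with ω h1 h2 using (h2 _).trans (h1 n)
  have hgm : ∀ n, AEMeasurable (fun ω ↦ ENNReal.ofReal (g n ω)) P :=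
    fun n ↦ (hgi n).1.aemeasurable.ennreal_ofReal
  have hlm : AEMeasurable (fun ω ↦ liminf (fun n ↦ ENNReal.ofReal (g n ω)) atTop) P := by
    simp only [liminf_eq_iSup_iInf_of_nat]
    exact AEMeasurable.iSup fun n ↦ AEMeasurable.biInf _ (Set.to_countable _) fun i _ ↦ hgm i
  calc ENNReal.ofReal x * P {ω | (∃ r < t, x < U r ω) ∧ ∀ s, V s ω ≤ x}
      ≤ ENNReal.ofReal x *
          P {ω | ENNReal.ofReal x ≤ liminf (fun n ↦ ENNReal.ofReal (g n ω)) atTop} := by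
        gcongr 1
        refine measure_mono_ae ?_
        filter_upwards [hUg, hσ, hUc] with ω h1 h2 hc
        rintro ⟨⟨r, hrt, hr⟩, hVx⟩
        refine le_liminf_of_le (by isBoundedDefault) ?_
        filter_upwards [h2] with n hn
        refine ENNReal.ofReal_le_ofReal ((le_exceedTime_value hD hc hVx hrt hr).trans ?_)
        have := h1 n
        rwa [hn] at this
    _ ≤ ∫⁻ ω, liminf (fun n ↦ ENNReal.ofReal (g n ω)) atTop ∂P :=
        mul_meas_ge_le_lintegral₀ hlm _
    _ ≤ liminf (fun n ↦ ∫⁻ ω, ENNReal.ofReal (g n ω) ∂P) atTop := lintegral_liminf_le' hgm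
    _ = ∫⁻ ω, Z ω ∂P := by simp only [hgl, liminf_const]

/-- Lenglart's domination inequality. -/
theorem mul_measure_totalSup_le [IsFiniteMeasure P]
    (hUa : StronglyAdapted 𝓕 U) (hVa : StronglyAdapted 𝓕 V)
    (hU0 : ∀ᵐ ω ∂P, ∀ t, 0 ≤ U t ω)
    (hUc : ∀ᵐ ω ∂P, ∀ t, ContinuousWithinAt (fun s ↦ U s ω) (Set.Ici t) t)
    (hVc : ∀ᵐ ω ∂P, ∀ t, ContinuousWithinAt (fun s ↦ V s ω) (Set.Ici t) t)
    (hV : ∀ᵐ ω ∂P, ∀ y : ℝ, 0 ≤ y → ∀ s, (∀ r < s, V r ω ≤ y) → V s ω ≤ y)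
    (hUV : IsLocallyCentered U V 𝓕 P) {x : ℝ} (hx : 0 < x) :
    ENNReal.ofReal x *
        P {ω | ENNReal.ofReal x < totalSup U ω ∧ totalSup V ω ≤ ENNReal.ofReal x} ≤
      ∫⁻ ω, min (totalSup V ω) (ENNReal.ofReal x) ∂P := by
  set E : ℕ → Set Ω := fun n ↦ {ω | (∃ r < (n : ℝ≥0), x < U r ω) ∧ ∀ s, V s ω ≤ x} with hE
  have hEmono : Monotone E := by
    rintro m n hmn ω ⟨⟨r, hr, h⟩, h'⟩
    exact ⟨⟨r, hr.trans_le (by exact_mod_cast hmn), h⟩, h'⟩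
  have hsub : {ω | ENNReal.ofReal x < totalSup U ω ∧ totalSup V ω ≤ ENNReal.ofReal x} ⊆
      ⋃ n, E n := by
    rintro ω ⟨h1, h2⟩
    obtain ⟨r, hr⟩ := lt_iSup_iff.1 h1
    obtain ⟨n, hn⟩ := exists_nat_gt r
    refine Set.mem_iUnion.2 ⟨n, ⟨r, hn, ((ENNReal.ofReal_lt_ofReal_iff_of_nonneg hx.le).1 hr)⟩,
      fun s ↦ ?_⟩
    exact (ENNReal.ofReal_le_ofReal_iff hx.le).1
      ((le_iSup (fun s ↦ ENNReal.ofReal (V s ω)) s).trans h2)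
  calc _ ≤ ENNReal.ofReal x * P (⋃ n, E n) := by gcongr
    _ = ⨆ n, ENNReal.ofReal x * P (E n) := by rw [hEmono.measure_iUnion, ENNReal.mul_iSup]
    _ ≤ _ := iSup_le fun n ↦ mul_measure_exceed_before_le hUa hVa hU0 hUc hVc hV hUV hx n

end Lenglart

/-! ### From tail estimates to moments -/

section LayerCake

lemma measurable_rpowDensity (k : ℝ) : Measurable fun x : ℝ ↦ ENNReal.ofReal (k * x ^ (k - 1)) := by
  fun_prop

lemma lintegral_Ioc_rpowDensity {k : ℝ} (hk : 0 < k) {z : ℝ} (hz : 0 ≤ z) :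
    ∫⁻ x in Set.Ioc 0 z, ENNReal.ofReal (k * x ^ (k - 1)) = ENNReal.ofReal (z ^ k) := by
  have hi : IntervalIntegrable (fun x : ℝ ↦ k * x ^ (k - 1)) volume 0 z :=
    (intervalIntegral.intervalIntegrable_rpow' (by linarith)).const_mul k
  rw [← ofReal_integral_eq_lintegral_ofReal
    ((intervalIntegrable_iff_integrableOn_Ioc_of_le hz).1 hi)]
  · rw [← intervalIntegral.integral_of_le hz, intervalIntegral.integral_const_mul,
      integral_rpow (Or.inl (by linarith))]
    rw [sub_add_cancel, Real.zero_rpow hk.ne', sub_zero, mul_div_cancel₀ _ hk.ne']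
  · filter_upwards [ae_restrict_mem measurableSet_Ioc] with x hx
    have := hx.1
    positivity

lemma lintegral_Ioi_rpowDensity {k : ℝ} (hk : 0 < k) (hk1 : k < 1) {z : ℝ} (hz : 0 < z) :
    ∫⁻ x in Set.Ioi z, ENNReal.ofReal (z * (k * x ^ (k - 2))) =
      ENNReal.ofReal (k / (1 - k) * z ^ k) := by
  rw [← ofReal_integral_eq_lintegral_ofReal]
  · rw [integral_const_mul, integral_const_mul, integral_Ioi_rpow_of_lt (by linarith) hz]
    congr 1
    have h1 : k - 2 + 1 = k - 1 := by ring
    have h2 : z ^ k = z ^ (k - 1) * z := by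
      rw [← Real.rpow_add_one hz.ne', sub_add_cancel]
    rw [h1, h2, ← neg_sub k 1, div_neg, neg_div, mul_neg, mul_neg, neg_mul]
    ring
  · exact ((integrableOn_Ioi_rpow_of_lt (by linarith) hz).const_mul k).const_mul z
  · filter_upwards [ae_restrict_mem measurableSet_Ioi] with x hx
    have : 0 < x := hz.trans hx
    positivity

/-- Layer cake for `z ↦ z ^ k` on `[0, ∞]`. -/
lemma rpow_eq_lintegral {k : ℝ} (hk : 0 < k) (z : ℝ≥0∞) :
    z ^ k = ∫⁻ x in Set.Ioi (0 : ℝ),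
      {x : ℝ | ENNReal.ofReal x < z}.indicator (fun x ↦ ENNReal.ofReal (k * x ^ (k - 1))) x := by
  have hm : ∀ z : ℝ≥0∞, MeasurableSet {x : ℝ | ENNReal.ofReal x < z} := fun z ↦
    measurableSet_lt ENNReal.measurable_ofReal measurable_const
  have hreal : ∀ z : ℝ, 0 ≤ z → ENNReal.ofReal (z ^ k) = ∫⁻ x in Set.Ioi (0 : ℝ),
      {x : ℝ | ENNReal.ofReal x < ENNReal.ofReal z}.indicator
        (fun x ↦ ENNReal.ofReal (k * x ^ (k - 1))) x := by
    intro z hz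
    rw [← lintegral_Ioc_rpowDensity hk hz, setLIntegral_congr Ioo_ae_eq_Ioc.symm,
      lintegral_indicator (hm _), Measure.restrict_restrict (hm _)]
    congr 2
    ext x
    simp only [Set.mem_Ioo, Set.mem_inter_iff, Set.mem_ofPred_eq, Set.mem_Ioi]
    constructor
    · exact fun h ↦ ⟨(ENNReal.ofReal_lt_ofReal_iff_of_nonneg h.1.le).2 h.2, h.1⟩
    · exact fun h ↦ ⟨h.2, (ENNReal.ofReal_lt_ofReal_iff_of_nonneg h.2.le).1 h.1⟩
  induction z with
  | coe z =>
    have := hreal z z.coe_nonneg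
    rwa [← ENNReal.ofReal_rpow_of_nonneg z.coe_nonneg hk.le, ENNReal.ofReal_coe_nnreal] at this
  | top =>
    rw [ENNReal.top_rpow_of_pos hk, eq_comm]
    -- The finite case at `r ^ (1/k)` bounds the integral below by any prescribed `r`.
    refine ENNReal.eq_top_of_forall_nnreal_le fun r ↦ ?_
    have h1 : ((r : ℝ) ^ k⁻¹) ^ k = r := by
      rw [← Real.rpow_mul r.coe_nonneg, inv_mul_cancel₀ hk.ne', Real.rpow_one]
    have h2 := hreal ((r : ℝ) ^ k⁻¹) (by positivity)
    rw [h1, ENNReal.ofReal_coe_nnreal] at h2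
    rw [h2]
    refine lintegral_mono fun x ↦ Set.indicator_le_indicator_of_subset ?_ (fun _ ↦ zero_le) x
    intro x _
    exact ENNReal.ofReal_lt_top

/-- Split at `x = z`. Below, the ratio is 1 and contributes `z^k`; above, it is `z/x` and
contributes `k/(1-k) z^k`, the tail converging because `k < 1`. -/
lemma lintegral_min_div {k : ℝ} (hk : 0 < k) (hk1 : k < 1) (z : ℝ≥0∞) :
    ∫⁻ x in Set.Ioi (0 : ℝ),
      min z (ENNReal.ofReal x) / ENNReal.ofReal x * ENNReal.ofReal (k * x ^ (k - 1)) ≤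
      ENNReal.ofReal (1 / (1 - k)) * z ^ k := by
  have hk1' : 0 < 1 - k := by linarith
  induction z with
  | top =>
    rw [ENNReal.top_rpow_of_pos hk, ENNReal.mul_top]
    · exact le_top
    · exact (ENNReal.ofReal_pos.2 (by positivity)).ne'
  | coe z =>
    rcases eq_or_ne z 0 with rfl | hz0
    · simp
    have hz : (0 : ℝ) < z := by exact_mod_cast pos_iff_ne_zero.2 hz0
    rw [← Set.Ioc_union_Ioi_eq_Ioi hz.le,
      lintegral_union measurableSet_Ioi (Set.Ioc_disjoint_Ioi le_rfl)]
    have h1 : ∫⁻ x in Set.Ioc (0 : ℝ) z, min (z : ℝ≥0∞) (ENNReal.ofReal x) / ENNReal.ofReal x *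
        ENNReal.ofReal (k * x ^ (k - 1)) = ENNReal.ofReal ((z : ℝ) ^ k) := by
      rw [← lintegral_Ioc_rpowDensity hk hz.le]
      refine setLIntegral_congr_fun measurableSet_Ioc fun x hx ↦ ?_
      have hx1 : ENNReal.ofReal x ≤ z := by
        rw [← ENNReal.ofReal_coe_nnreal]
        exact ENNReal.ofReal_le_ofReal hx.2
      rw [min_eq_right hx1, ENNReal.div_self (ENNReal.ofReal_pos.2 hx.1).ne' ENNReal.ofReal_ne_top,
        one_mul]
    have h2 : ∫⁻ x in Set.Ioi (z : ℝ), min (z : ℝ≥0∞) (ENNReal.ofReal x) / ENNReal.ofReal x *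
        ENNReal.ofReal (k * x ^ (k - 1)) = ENNReal.ofReal (k / (1 - k) * (z : ℝ) ^ k) := by
      rw [← lintegral_Ioi_rpowDensity hk hk1 hz]
      refine setLIntegral_congr_fun measurableSet_Ioi fun x hx ↦ ?_
      have hx0 : 0 < x := hz.trans hx
      have hx1 : (z : ℝ≥0∞) ≤ ENNReal.ofReal x := by
        rw [← ENNReal.ofReal_coe_nnreal]
        exact ENNReal.ofReal_le_ofReal (le_of_lt hx)
      rw [min_eq_left hx1, ← ENNReal.ofReal_coe_nnreal, ← ENNReal.ofReal_div_of_pos hx0,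
        ← ENNReal.ofReal_mul (by positivity)]
      congr 1
      have : x ^ (k - 1) = x ^ (k - 2) * x := by
        rw [← Real.rpow_add_one hx0.ne']
        ring_nf
      rw [this]
      field_simp
    rw [h1, h2, ← ENNReal.ofReal_add (by positivity) (by positivity),
      ← ENNReal.ofReal_coe_nnreal, ENNReal.ofReal_rpow_of_nonneg hz.le hk.le,
      ← ENNReal.ofReal_mul (by positivity)]
    refine ENNReal.ofReal_le_ofReal (le_of_eq ?_)
    field_simp
    ring

/-- A weak-type domination of `Y` by `Z` integrates to a bound on `k`-th moments, `k < 1`. -/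
theorem lintegral_rpow_le_of_mul_measure_le {Ω : Type*} [MeasurableSpace Ω] {P : Measure Ω}
    [IsFiniteMeasure P] {Y Z : Ω → ℝ≥0∞} (hY : AEMeasurable Y P) (hZ : AEMeasurable Z P)
    (h : ∀ x : ℝ, 0 < x → ENNReal.ofReal x *
      P {ω | ENNReal.ofReal x < Y ω ∧ Z ω ≤ ENNReal.ofReal x} ≤
        ∫⁻ ω, min (Z ω) (ENNReal.ofReal x) ∂P)
    {k : ℝ} (hk : 0 < k) (hk1 : k < 1) :
    ∫⁻ ω, Y ω ^ k ∂P ≤ ENNReal.ofReal ((2 - k) / (1 - k)) * ∫⁻ ω, Z ω ^ k ∂P := by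
  have hk1' : 0 < 1 - k := by linarith
  wlog hmeas : Measurable Y ∧ Measurable Z generalizing Y Z
  · have hYZ : ∀ᵐ ω ∂P, Y ω = hY.mk Y ω ∧ Z ω = hZ.mk Z ω := hY.ae_eq_mk.and hZ.ae_eq_mk
    rw [lintegral_congr_ae (hYZ.mono fun ω hω ↦ by simp only [hω.1] :
        (fun ω ↦ Y ω ^ k) =ᵐ[P] fun ω ↦ hY.mk Y ω ^ k),
      lintegral_congr_ae (hYZ.mono fun ω hω ↦ by simp only [hω.2] :
        (fun ω ↦ Z ω ^ k) =ᵐ[P] fun ω ↦ hZ.mk Z ω ^ k)]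
    refine this hY.measurable_mk.aemeasurable hZ.measurable_mk.aemeasurable (fun x hx ↦ ?_)
      ⟨hY.measurable_mk, hZ.measurable_mk⟩
    convert h x hx using 1
    · congr 1
      refine measure_congr ?_
      filter_upwards [hYZ] with ω hω
      refine propext ?_
      change (_ < hY.mk Y ω ∧ hZ.mk Z ω ≤ _) ↔ (_ < Y ω ∧ Z ω ≤ _)
      rw [hω.1, hω.2]
    · exact lintegral_congr_ae (hYZ.mono fun ω hω ↦ by simp only [hω.2])
  obtain ⟨hYm, hZm⟩ := hmeas
  set d : ℝ → ℝ≥0∞ := fun x ↦ ENNReal.ofReal (k * x ^ (k - 1)) with hd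
  have hdm : Measurable d := measurable_rpowDensity k
  have hcake : ∀ W : Ω → ℝ≥0∞, Measurable W → ∫⁻ ω, W ω ^ k ∂P =
      ∫⁻ x in Set.Ioi (0 : ℝ), P {ω | ENNReal.ofReal x < W ω} * d x := by
    intro W hW
    simp_rw [fun ω ↦ rpow_eq_lintegral hk (W ω)]
    rw [lintegral_lintegral_swap]
    · refine lintegral_congr fun x ↦ ?_
      have hs : MeasurableSet {ω | ENNReal.ofReal x < W ω} := measurableSet_lt measurable_const hW
      rw [mul_comm, ← lintegral_indicator_const hs]
      rfl
    · have hset : MeasurableSet {p : Ω × ℝ | ENNReal.ofReal p.2 < W p.1} :=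
        measurableSet_lt (ENNReal.measurable_ofReal.comp measurable_snd) (hW.comp measurable_fst)
      exact ((hdm.comp measurable_snd).indicator hset).aemeasurable
  -- Either `Z` already exceeds `x`, or the weak-type hypothesis applies.
  have hbound : ∀ x : ℝ, 0 < x → P {ω | ENNReal.ofReal x < Y ω} ≤
      P {ω | ENNReal.ofReal x < Z ω} +
        (∫⁻ ω, min (Z ω) (ENNReal.ofReal x) ∂P) / ENNReal.ofReal x := by
    intro x hx
    have h1 : {ω | ENNReal.ofReal x < Y ω} ⊆ {ω | ENNReal.ofReal x < Z ω} ∪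
        {ω | ENNReal.ofReal x < Y ω ∧ Z ω ≤ ENNReal.ofReal x} := fun ω hω ↦
      (lt_or_ge (ENNReal.ofReal x) (Z ω)).imp id fun h ↦ ⟨hω, h⟩
    refine (measure_mono h1).trans ((measure_union_le _ _).trans ?_)
    gcongr
    rw [ENNReal.le_div_iff_mul_le (Or.inl (ENNReal.ofReal_pos.2 hx).ne')
      (Or.inl ENNReal.ofReal_ne_top), mul_comm]
    exact h x hx
  have hjm : Measurable fun p : ℝ × Ω ↦
      min (Z p.2) (ENNReal.ofReal p.1) / ENNReal.ofReal p.1 * d p.1 := by fun_prop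
  calc ∫⁻ ω, Y ω ^ k ∂P
      = ∫⁻ x in Set.Ioi (0 : ℝ), P {ω | ENNReal.ofReal x < Y ω} * d x := hcake Y hYm
    _ ≤ ∫⁻ x in Set.Ioi (0 : ℝ), (P {ω | ENNReal.ofReal x < Z ω} * d x +
          ∫⁻ ω, min (Z ω) (ENNReal.ofReal x) / ENNReal.ofReal x * d x ∂P) := by
        refine setLIntegral_mono' measurableSet_Ioi fun x hx ↦ ?_
        refine (mul_le_mul_left (hbound x hx) (d x)).trans (le_of_eq ?_)
        rw [add_mul, lintegral_mul_const, ENNReal.div_eq_inv_mul, ← lintegral_const_mul]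
        · simp only [ENNReal.div_eq_inv_mul]
        · fun_prop
        · fun_prop
    _ = (∫⁻ x in Set.Ioi (0 : ℝ), P {ω | ENNReal.ofReal x < Z ω} * d x) +
          ∫⁻ x in Set.Ioi (0 : ℝ),
            ∫⁻ ω, min (Z ω) (ENNReal.ofReal x) / ENNReal.ofReal x * d x ∂P :=
        lintegral_add_right _ hjm.lintegral_prod_right'
    _ = ∫⁻ ω, Z ω ^ k ∂P + ∫⁻ ω, (∫⁻ x in Set.Ioi (0 : ℝ),
            min (Z ω) (ENNReal.ofReal x) / ENNReal.ofReal x * d x) ∂P := by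
        rw [← hcake Z hZm, lintegral_lintegral_swap hjm.aemeasurable]
    _ ≤ ∫⁻ ω, Z ω ^ k ∂P + ∫⁻ ω, ENNReal.ofReal (1 / (1 - k)) * Z ω ^ k ∂P := by
        gcongr with ω
        exact lintegral_min_div hk hk1 (Z ω)
    _ = ENNReal.ofReal ((2 - k) / (1 - k)) * ∫⁻ ω, Z ω ^ k ∂P := by
        rw [lintegral_const_mul _ (by fun_prop), ← one_add_mul, ← ENNReal.ofReal_one,
          ← ENNReal.ofReal_add zero_le_one (by positivity)]
        congr 2
        field_simp
        ring

end LayerCake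

/-! ### Continuity of the running supremum -/

section RunningSup

variable {Ω : Type*} {Y : ℝ≥0 → Ω → ℝ} {ω : Ω}

lemma monotone_runningSup (Y : ℝ≥0 → Ω → ℝ) (ω : Ω) : Monotone fun t ↦ runningSup Y t ω :=
  fun _ t hst ↦ iSup_le fun r ↦
    le_iSup (fun r : Set.Iic t ↦ ENNReal.ofReal (Y r ω)) ⟨r, r.2.trans hst⟩

lemma ofReal_le_runningSup {s t : ℝ≥0} (h : s ≤ t) : ENNReal.ofReal (Y s ω) ≤ runningSup Y t ω :=
  le_iSup (fun r : Set.Iic t ↦ ENNReal.ofReal (Y r ω)) ⟨s, h⟩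

/-- A process with continuous running supremum does not overshoot a level it has not exceeded. -/
lemma le_of_forall_lt_le_of_continuous_runningSup (hY : Continuous fun t ↦ runningSup Y t ω)
    (h0 : Y 0 ω = 0) {y : ℝ} (hy : 0 ≤ y) {s : ℝ≥0} (h : ∀ r < s, Y r ω ≤ y) : Y s ω ≤ y := by
  rcases eq_or_ne s 0 with rfl | hs
  · rwa [h0]
  have : (𝓝[<] s).NeBot := nhdsLT_neBot_of_exists_lt ⟨0, pos_iff_ne_zero.2 hs⟩
  refine (ENNReal.ofReal_le_ofReal_iff hy).1 ((ofReal_le_runningSup le_rfl).trans ?_)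
  refine le_of_tendsto (hY.continuousAt.tendsto.mono_left (nhdsWithin_le_nhds (s := Set.Iio s))) ?_
  filter_upwards [self_mem_nhdsWithin] with r hr
  exact iSup_le fun q ↦ ENNReal.ofReal_le_ofReal (h _ (q.2.trans_lt hr))

/-- The running supremum of a càdlàg path with no positive jump is continuous. -/
lemma continuous_runningSup (hY : IsCadlagPath fun t ↦ Y t ω)
    (hj : ∀ t, Y t ω - Function.leftLim (fun s ↦ Y s ω) t ≤ 0) :
    Continuous fun t ↦ runningSup Y t ω := by
  refine continuous_iff_continuousAt.2 fun t ↦ continuousAt_iff_continuous_left'_right'.2 ⟨?_, ?_⟩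
  · rcases eq_or_ne t 0 with rfl | ht
    · simp [ContinuousWithinAt]
    have htpos : 0 < t := pos_iff_ne_zero.2 ht
    refine tendsto_order.2 ⟨fun a ha ↦ ?_, fun a ha ↦ ?_⟩
    · obtain ⟨⟨s, hs⟩, hsa⟩ := lt_iSup_iff.1 ha
      rcases (Set.mem_Iic.1 hs).lt_or_eq with hlt | rfl
      · filter_upwards [Ioo_mem_nhdsLT hlt] with r hr
        exact hsa.trans_le (ofReal_le_runningSup hr.1.le)
      -- With no upward jump, the left limit is at least the value, so times just before already
      -- exceed `a`.
      · have hlim := tendsto_leftLim_of_tendsto (hY s).2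
        have h1 : a < ENNReal.ofReal (Function.leftLim (fun s ↦ Y s ω) s) :=
          hsa.trans_le (ENNReal.ofReal_le_ofReal (by linarith [hj s]))
        filter_upwards [(ENNReal.tendsto_ofReal hlim).eventually (lt_mem_nhds h1)] with r hr
        exact hr.trans_le (ofReal_le_runningSup le_rfl)
    · filter_upwards [self_mem_nhdsWithin] with r hr
      exact (monotone_runningSup Y ω (le_of_lt hr)).trans_lt ha
  · refine tendsto_order.2 ⟨fun a ha ↦ ?_, fun a ha ↦ ?_⟩
    · filter_upwards [self_mem_nhdsWithin] with r hr
      exact ha.trans_le (monotone_runningSup Y ω (le_of_lt hr))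
    -- Right-continuity keeps the path below `c` just after `t`; the intermediate `c` keeps the
    -- supremum strictly below `a`.
    · obtain ⟨c, hc, hca⟩ := exists_between ha
      have h1 : ∀ᶠ s in 𝓝[≥] t, ENNReal.ofReal (Y s ω) < c :=
        (ENNReal.tendsto_ofReal (hY t).1).eventually
          (gt_mem_nhds ((ofReal_le_runningSup le_rfl).trans_lt hc))
      obtain ⟨u, hu, hu'⟩ := (mem_nhdsGE_iff_exists_Ico_subset' (lt_add_one t)).1 h1
      filter_upwards [Ioo_mem_nhdsGT hu] with r hr
      refine lt_of_le_of_lt (iSup_le fun q ↦ ?_) hca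
      rcases lt_or_ge (q : ℝ≥0) t with hq | hq
      · exact (ofReal_le_runningSup hq.le).trans hc.le
      · exact le_of_lt (hu' ⟨hq, q.2.trans_lt hr.2⟩)

end RunningSup

/-! ### Moment bounds and centering of the decomposition -/

section Moments

variable {Ω : Type*} [mΩ : MeasurableSpace Ω] {P : Measure Ω} {𝓕 : Filtration ℝ≥0 mΩ}
  {U V X N A : ℝ≥0 → Ω → ℝ}

theorem lintegral_totalSup_rpow_le [IsFiniteMeasure P]
    (hUa : StronglyAdapted 𝓕 U) (hVa : StronglyAdapted 𝓕 V)
    (hU0 : ∀ᵐ ω ∂P, ∀ t, 0 ≤ U t ω)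
    (hUc : ∀ᵐ ω ∂P, ∀ t, ContinuousWithinAt (fun s ↦ U s ω) (Set.Ici t) t)
    (hVc : ∀ᵐ ω ∂P, ∀ t, ContinuousWithinAt (fun s ↦ V s ω) (Set.Ici t) t)
    (hV : ∀ᵐ ω ∂P, ∀ y : ℝ, 0 ≤ y → ∀ s, (∀ r < s, V r ω ≤ y) → V s ω ≤ y)
    (hUV : IsLocallyCentered U V 𝓕 P) {k : ℝ} (hk : 0 < k) (hk1 : k < 1) :
    ∫⁻ ω, totalSup U ω ^ k ∂P ≤
      ENNReal.ofReal ((2 - k) / (1 - k)) * ∫⁻ ω, totalSup V ω ^ k ∂P :=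
  lintegral_rpow_le_of_mul_measure_le (aemeasurable_totalSup hUa hUc)
    (aemeasurable_totalSup hVa hVc)
    (fun _ hx ↦ mul_measure_totalSup_le hUa hVa hU0 hUc hVc hV hUV hx) hk hk1

lemma IsLocallyCentered.symm (h : IsLocallyCentered U V 𝓕 P) : IsLocallyCentered V U 𝓕 P := by
  intro S hS t hSt
  obtain ⟨σ, h1, h2, h3⟩ := h S hS t hSt
  refine ⟨σ, h1, h2, fun n ↦ ?_⟩
  have hneg : (fun ω ↦ V (σ n ω) ω - U (σ n ω) ω) =
      fun ω ↦ -(U (σ n ω) ω - V (σ n ω) ω) := by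
    ext ω
    ring
  rw [hneg, integral_neg, (h3 n).2, neg_zero]
  exact ⟨(h3 n).1.neg, rfl⟩

namespace IsPositiveLocalSubmartingaleDecomp

lemma isCadlagPath (h : IsPositiveLocalSubmartingaleDecomp X N A 𝓕 P) :
    ∀ᵐ ω ∂P, IsCadlagPath fun t ↦ X t ω := by
  filter_upwards [h.cadlag, h.increasing.continuous, h.decomp] with ω hN hA hX t
  obtain ⟨hr, l, hl⟩ := hN t
  simp only [hX]
  exact ⟨hr.add hA.continuousWithinAt, l + A t ω,
    hl.add (hA.continuousAt.tendsto.mono_left nhdsWithin_le_nhds)⟩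

lemma isLocallyCentered [IsFiniteMeasure P]
    (h : IsPositiveLocalSubmartingaleDecomp X N A 𝓕 P) : IsLocallyCentered X A 𝓕 P := by
  intro S hS t hSt
  obtain ⟨σ, h1, h2, h3⟩ := h.localMartingale.exists_seq_integral_eq_zero
    (h.cadlag.mono fun ω hω t ↦ (hω t).1) h.zero hS hSt
  refine ⟨σ, h1, h2, fun n ↦ ?_⟩
  have he : (fun ω ↦ N (σ n ω) ω) =ᵐ[P] fun ω ↦ X (σ n ω) ω - A (σ n ω) ω := by
    filter_upwards [h.decomp] with ω hω
    rw [hω, add_sub_cancel_right]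
  exact ⟨(h3 n).1.congr he, (integral_congr_ae he).symm.trans (h3 n).2⟩

end IsPositiveLocalSubmartingaleDecomp

end Moments

end LocalSubmart

theorem mainTheorem10 {Ω : Type*} [mΩ : MeasurableSpace Ω] (P : Measure Ω)
    [IsProbabilityMeasure P] (𝓕 : Filtration ℝ≥0 mΩ) (X N A : ℝ≥0 → Ω → ℝ)
    (h : LocalSubmart.IsPositiveLocalSubmartingaleDecomp X N A 𝓕 P) :
    (∀ k : ℝ, 0 < k → k < 1 →
      ∫⁻ ω, LocalSubmart.totalSup X ω ^ k ∂P ≤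
        ENNReal.ofReal ((2 - k) / (1 - k)) * ∫⁻ ω, LocalSubmart.totalSup A ω ^ k ∂P) ∧
    ((∀ᵐ ω ∂P, Continuous fun t ↦ LocalSubmart.runningSup X t ω) →
      ∀ k : ℝ, 0 < k → k < 1 →
        ∫⁻ ω, LocalSubmart.totalSup A ω ^ k ∂P ≤
          ENNReal.ofReal ((2 - k) / (1 - k)) * ∫⁻ ω, LocalSubmart.totalSup X ω ^ k ∂P ∧
        ENNReal.ofReal ((2 - k) / (1 - k)) * ∫⁻ ω, LocalSubmart.totalSup A ω ^ k ∂P ≤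
          ENNReal.ofReal (((2 - k) / (1 - k)) ^ 2) *
            ∫⁻ ω, LocalSubmart.totalSup X ω ^ k ∂P) ∧
    (LocalSubmart.HasOnlyNegativeJumps X P →
      ∀ᵐ ω ∂P, Continuous fun t ↦ LocalSubmart.runningSup X t ω) := by
  have hXa := h.localSubmartingale.1
  have hAa := h.increasing.adapted
  have hXc : ∀ᵐ ω ∂P, ∀ t, ContinuousWithinAt (fun s ↦ X s ω) (Set.Ici t) t :=
    h.isCadlagPath.mono fun ω hω t ↦ (hω t).1
  have hAc : ∀ᵐ ω ∂P, ∀ t, ContinuousWithinAt (fun s ↦ A s ω) (Set.Ici t) t :=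
    h.increasing.continuous.mono fun ω hω t ↦ hω.continuousWithinAt
  have hA0 : ∀ᵐ ω ∂P, ∀ t, 0 ≤ A t ω := by
    filter_upwards [h.increasing.monotone, h.increasing.zero] with ω hm h0 t
    exact h0.symm.le.trans (hm zero_le)
  have hUV := h.isLocallyCentered
  refine ⟨fun k hk hk1 ↦ ?_, fun hcont k hk hk1 ↦ ?_, fun hj ↦ ?_⟩
  · refine LocalSubmart.lintegral_totalSup_rpow_le hXa hAa h.nonneg hXc hAc ?_ hUV hk hk1
    -- A continuous path inherits a bound from its left limit; time zero has no past and needs `A 0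
    -- = 0`.
    filter_upwards [h.increasing.continuous, h.increasing.zero] with ω hc h0 y hy s hs
    rcases eq_or_ne s 0 with rfl | hs0
    · rwa [h0]
    have : (𝓝[<] s).NeBot := nhdsLT_neBot_of_exists_lt ⟨0, pos_iff_ne_zero.2 hs0⟩
    exact le_of_tendsto (hc.continuousAt.tendsto.mono_left (nhdsWithin_le_nhds (s := Set.Iio s)))
      (eventually_nhdsWithin_of_forall hs)
  · have hmain : ∫⁻ ω, LocalSubmart.totalSup A ω ^ k ∂P ≤
        ENNReal.ofReal ((2 - k) / (1 - k)) * ∫⁻ ω, LocalSubmart.totalSup X ω ^ k ∂P := by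
      refine LocalSubmart.lintegral_totalSup_rpow_le hAa hXa hA0 hAc hXc ?_ hUV.symm hk hk1
      filter_upwards [hcont, h.decomp, h.zero, h.increasing.zero] with ω hc hd h1 h2 y hy s hs
      exact LocalSubmart.le_of_forall_lt_le_of_continuous_runningSup hc
        (by rw [hd, h1, h2, add_zero]) hy hs
    refine ⟨hmain, ?_⟩
    have hc0 : 0 ≤ (2 - k) / (1 - k) := div_nonneg (by linarith) (by linarith)
    rw [ENNReal.ofReal_pow hc0, sq, mul_assoc]
    gcongr
  · filter_upwards [h.isCadlagPath, hj] with ω h1 h2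
    exact LocalSubmart.continuous_runningSup h1 h2
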